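/- Let $N\ge 1$, $L\ge 2$, and let $n_0,n_1,\dots,n_L$ be layer widths, where $d=n_0$ is the input dimension and $m=n_L$ the output dimension. Let $X\in\mathbb{R}^{N\times d}$ be a data matrix whose $N$ rows (the training samples) are pairwise distinct, let $\sigma:\mathbb{R}\to\mathbb{R}$ be continuous, and let $\varphi:\mathbb{R}^{N\times m}\to\mathbb{R}$ be convex. For parameters $\theta=(W_l,b_l)_{l=1}^L\in\Omega$, with $W_l\in\mathbb{R}^{n_{l-1}\times n_l}$ and $b_l\in\mathbb{R}^{n_l}$, put $F_0=X$, $F_k=\sigma(F_{k-1}W_k+\mathbf{1}_Nb_k^T)$ for $1\le k\le L-1$ (with $\sigma$ applied entrywise), $F_L=F_{L-1}W_L+\mathbf{1}_Nb_L^T$, and let $\Phi(\theta)=\varphi(F_L(\theta))$ be the training loss $\Phi:\Omega\to\mathbb{R}$. Call a set $S$ connected if any two points of $S$ can be joined by a continuous curve in $S$ (so that the empty set is connected); a connected component of a set is a nonempty maximal connected subset of it. Assume that 1. $\sigma$ is strictly monotonic and $\sigma(\mathbb{R})=\mathbb{R}$; 2. there do not exist non-zero reals $\lambda_1,\dots,\lambda_p$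 and pairwise distinct non-zero reals $a_1,\dots,a_p$ such that $\sigma(x)=\sum_{i=1}^p\lambda_i\,\sigma(x-a_i)$ for every $x\in\mathbb{R}$; 3. $n_1\ge 2N$ and $n_2>n_3>\dots>n_L$ (no condition on $n_2$ if $L=2$). Then for every $\alpha\in\mathbb{R}$ the sublevel set $\{\theta\in\Omega:\Phi(\theta)\le\alpha\}$ is connected, and every connected component of the level set $\{\theta\in\Omega:\Phi(\theta)=\alpha\}$ is unbounded. In particular, all global minima lie in one unique valley: the set of global minimizers of $\Phi$ on $\Omega$ is connected, and for every $\alpha\in\mathbb{R}$ the strict sublevel set $\{\theta\in\Omega:\Phi(\theta)<\alpha\}$ has at most one connected component (local valley), which, if there is one, contains all global minimizers of $\Phi$. -/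

import Mathlib

namespace DeepNet

/-- A set is connected if any two of its points are joined by a continuous curve
`r : [0,1] → S` inside it (the empty set is allowed). -/
def CurveConnected {E : Type*} [TopologicalSpace E] (S : Set E) : Prop :=
  ∀ x ∈ S, ∀ y ∈ S, JoinedIn S x y

/-- `C` is a (nonempty) connected component of `S`: a maximal connected subset of `S`. -/
def IsComponent {E : Type*} [TopologicalSpace E] (S C : Set E) : Prop :=
  C.Nonempty ∧ Maximal (fun D : Set E => D ⊆ S ∧ CurveConnected D) C

/-- `σ` is strictly monotonic (increasing or decreasing) and `σ(ℝ) = ℝ`. -/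
def StrictlyMonotoneOnto (σ : ℝ → ℝ) : Prop :=
  (StrictMono σ ∨ StrictAnti σ) ∧ Set.range σ = Set.univ

/-- There are no non-zero `λ_i` and pairwise distinct non-zero `a_i`, `i = 1, …, p`, with
`σ(x) = ∑ i, λ_i σ(x - a_i)` for every real `x`. -/
def NoTranslateRelation (σ : ℝ → ℝ) : Prop :=
  ¬ ∃ (p : ℕ) (c a : Fin p → ℝ),
      (∀ i, c i ≠ 0) ∧ (∀ i, a i ≠ 0) ∧ (∀ i j, i ≠ j → a i ≠ a j) ∧
        ∀ x : ℝ, σ x = ∑ i, c i * σ (x - a i)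

/-- The parameter space `Ω = Ω₁ × ⋯ × Ω_L` of a network with `L` layers, layer `k` having
width `n k` (and `n 0` the input dimension, `n L` the output dimension). For `θ : Params L n`, the
entry `θ l` is the pair of weight matrix and bias vector of layer `l + 1`. Only the values
`n 0, …, n L` matter. -/
abbrev Params (L : ℕ) (n : ℕ → ℕ) : Type :=
  (l : Fin L) → Matrix (Fin (n l)) (Fin (n (l + 1))) ℝ × (Fin (n (l + 1)) → ℝ)

/-- The output `F_k(θ)` of layer `k` on the data matrix `X`, whose rows are the samples:
`F_0 = X`, `F_k = σ(F_{k-1} W_k + 1 b_kᵀ)` for `1 ≤ k ≤ L - 1` with `σ` applied entrywise, and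
`F_L = F_{L-1} W_L + 1 b_Lᵀ`. -/
def layerOutput {N L : ℕ} {n : ℕ → ℕ} (σ : ℝ → ℝ) (X : Matrix (Fin N) (Fin (n 0)) ℝ)
    (θ : Params L n) : (k : ℕ) → k ≤ L → Matrix (Fin N) (Fin (n k)) ℝ
  | 0, _ => X
  | k + 1, h =>
      let A : Matrix (Fin N) (Fin (n (k + 1))) ℝ :=
        layerOutput σ X θ k (Nat.le_of_succ_le h) * (θ ⟨k, h⟩).1
          + Matrix.of (fun _ j => (θ ⟨k, h⟩).2 j)
      if k + 1 = L then A else A.map σ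

/-- The training loss `Φ(θ) = φ(F_L(θ))`. -/
def loss {N L : ℕ} {n : ℕ → ℕ} (σ : ℝ → ℝ) (X : Matrix (Fin N) (Fin (n 0)) ℝ)
    (φ : Matrix (Fin N) (Fin (n L)) ℝ → ℝ) (θ : Params L n) : ℝ :=
  φ (layerOutput σ X θ L le_rfl)

/-- The `α`-sublevel set of `Φ`. -/
def sublevelSet {E : Type*} (Φ : E → ℝ) (α : ℝ) : Set E := {θ | Φ θ ≤ α}

/-- The strict `α`-sublevel set of `Φ`. -/
def strictSublevelSet {E : Type*} (Φ : E → ℝ) (α : ℝ) : Set E := {θ | Φ θ < α}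

/-- The `α`-level set of `Φ`. -/
def levelSet {E : Type*} (Φ : E → ℝ) (α : ℝ) : Set E := {θ | Φ θ = α}

/-- The set of global minimizers of `Φ`. -/
def globalMinima {E : Type*} (Φ : E → ℝ) : Set E := {θ | ∀ θ', Φ θ ≤ Φ θ'}

/-- A set of parameters is bounded if all weights and biases are bounded by a common constant
(which is boundedness in any norm, as the parameter space is finite-dimensional). -/
def BoundedParams {L : ℕ} {n : ℕ → ℕ} (C : Set (Params L n)) : Prop :=
  ∃ R : ℝ, ∀ θ ∈ C, ∀ l : Fin L,
    (∀ i j, |(θ l).1 i j| ≤ R) ∧ (∀ j, |(θ l).2 j| ≤ R)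

end DeepNet

/-!
A map through which paths can be lifted, once their end points have been moved inside the fibres,
pulls back connected sets to connected sets. Each layer from the third on gives such a map, and so
do the first two layers together, so a connected set of outputs, such as a sublevel set of `φ`, can
be pulled back layer by layer.

If the width decreases from `p` to `q < p`, then `(F, W) ↦ F * W` lifts paths: `W` can be made
injective without changing the product, the injective matrices form a connected set, and a left
inverse of `W` depending continuously on `W` turns a path of products into a path of `F`s. The bias
only translates the product and the activation is a homeomorphism.

The data are fixed, so the first layer has no such freedom. The features `σ (X w + b)` of a hidden
neuron, however, span `ℝ^N`, as the samples are distinct on some line and `σ` satisfies no translate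
relation. Since at most `N` neurons are needed to span the column space of `F_1`, among `2 * N`
neurons at least `N` can be disconnected from the output and replaced by a spanning family, after
which the weights of the second layer alone can produce any path.

Disconnecting a superfluous neuron also leaves its bias free to go to infinity inside a fibre of the
network, so the components of the level sets are unbounded.
-/

namespace DeepNet

open Set Matrix Function Module

section CurveLifting

variable {E E' B Z : Type*} [TopologicalSpace E] [TopologicalSpace E'] [TopologicalSpace B]
  [TopologicalSpace Z]

theorem joinedIn_map_of_mapsTo {S : Set E} {T : Set B} {x y : E} (h : JoinedIn S x y) {f : E → B}
    (hf : Continuous f) (hST : MapsTo f S T) : JoinedIn T (f x) (f y) :=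
  (h.map hf).mono hST.image_subset

theorem curveConnected_of_convex [AddCommGroup E] [Module ℝ E] [ContinuousAdd E]
    [ContinuousSMul ℝ E] {S : Set E} (hS : Convex ℝ S) : CurveConnected S :=
  fun _ hx _ hy => .of_segment_subset (hS.segment_subset hx hy)

theorem CurveConnected.preimage_homeomorph {S : Set E'} (hS : CurveConnected S) (e : E ≃ₜ E') :
    CurveConnected (e ⁻¹' S) := by
  intro x hx y hy
  simpa using joinedIn_map_of_mapsTo (T := e ⁻¹' S) (hS _ hx _ hy) e.symm.continuous
    fun z hz => by simpa using hz

theorem curveConnected_univ [PathConnectedSpace E] : CurveConnected (univ : Set E) :=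
  fun x _ y _ => joinedIn_univ.2 (PathConnectedSpace.joined x y)

theorem CurveConnected.prod {S : Set E} {T : Set E'} (hS : CurveConnected S)
    (hT : CurveConnected T) : CurveConnected (S ×ˢ T) :=
  fun _ hx _ hy => (hS _ hx.1 _ hy.1).prod (hT _ hx.2 _ hy.2)

/-- A weak form of path lifting for `f`: a path in the target between two values `f x` and `f y`
is the image of a path in the source whose end points may differ from `x` and `y`, provided that
they can be reached from `x` and `y` inside the fibres of `f`. This is what is needed to pull
back connectedness along `f`. -/
def LiftsCurves (f : E → B) : Prop :=
  ∀ ⦃x y : E⦄ (γ : Path (f x) (f y)), ∃ x' y' : E,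
    JoinedIn (f ⁻¹' {f x}) x x' ∧ JoinedIn (f ⁻¹' {f y}) y y' ∧
      ∃ γ' : Path x' y', ∀ t, f (γ' t) = γ t

theorem LiftsCurves.curveConnected_preimage {f : E → B} (hf : LiftsCurves f) {S : Set B}
    (hS : CurveConnected S) : CurveConnected (f ⁻¹' S) := by
  intro x hx y hy
  have in_fibre {z z' : E} (hz : f z ∈ S) (h : JoinedIn (f ⁻¹' {f z}) z z') :
      JoinedIn (f ⁻¹' S) z z' := h.mono (preimage_mono (singleton_subset_iff.2 hz))
  obtain ⟨γ, hγ⟩ := hS _ hx _ hy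
  obtain ⟨x', y', hx', hy', γ', hγ'⟩ := hf γ
  have h_lift : JoinedIn (f ⁻¹' S) x' y' := ⟨γ', fun t => by
    simpa only [mem_preimage, hγ'] using hγ t⟩
  exact (in_fibre hx hx').trans (h_lift.trans (in_fibre hy hy').symm)

theorem LiftsCurves.prodMap_id {f : E → B} (hf : LiftsCurves f) :
    LiftsCurves (Prod.map f (id : Z → Z)) := by
  rintro ⟨x, z⟩ ⟨y, w⟩ γ
  have in_fibre {x x' : E} (z : Z) (h : JoinedIn (f ⁻¹' {f x}) x x') :
      JoinedIn (Prod.map f id ⁻¹' {Prod.map f id (x, z)}) (x, z) (x', z) :=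
    joinedIn_map_of_mapsTo (f := (·, z)) h (by fun_prop) fun u hu => Prod.ext hu rfl
  obtain ⟨x', y', hx', hy', γ', hγ'⟩ := hf (x := x) (y := y) (γ.map continuous_fst)
  refine ⟨(x', z), (y', w), in_fibre z hx', in_fibre w hy',
    γ'.prod (γ.map continuous_snd), fun t => Prod.ext (hγ' t) rfl⟩

theorem LiftsCurves.homeomorph_comp {B' : Type*} [TopologicalSpace B'] {f : E → B}
    (hf : LiftsCurves f) (e : B ≃ₜ B') : LiftsCurves (e ∘ f) := by
  intro x y γ
  have in_fibre {z z' : E} (h : JoinedIn (f ⁻¹' {f z}) z z') :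
      JoinedIn ((e ∘ f) ⁻¹' {(e ∘ f) z}) z z' := h.mono fun u hu => congrArg e hu
  obtain ⟨x', y', hx', hy', γ', hγ'⟩ :=
    hf ((γ.map e.symm.continuous).cast (e.symm_apply_apply _).symm (e.symm_apply_apply _).symm)
  exact ⟨x', y', in_fibre hx', in_fibre hy', γ', fun t => by simp [hγ']⟩

theorem LiftsCurves.add {D : Type*} [TopologicalSpace D] [AddCommGroup D]
    [IsTopologicalAddGroup D] [PathConnectedSpace Z] {f : E → D} (hf : LiftsCurves f) {g : Z → D}
    (hg : Continuous g) : LiftsCurves fun x : E × Z => f x.1 + g x.2 := by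
  rintro ⟨x, z⟩ ⟨y, w⟩ γ
  have in_fibre {x x' : E} (z : Z) (h : JoinedIn (f ⁻¹' {f x}) x x') :
      JoinedIn ((fun x : E × Z => f x.1 + g x.2) ⁻¹' {f x + g z}) (x, z) (x', z) :=
    joinedIn_map_of_mapsTo (f := (·, z)) h (by fun_prop) fun u hu => congrArg (· + g z) hu
  let ζ : Path z w := PathConnectedSpace.somePath z w
  let γ₀ : Path (f x) (f y) :=
    { toFun := fun t => γ t - g (ζ t)
      source' := by simp
      target' := by simp }
  obtain ⟨x', y', hx', hy', γ', hγ'⟩ := hf γ₀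
  exact ⟨(x', z), (y', w), in_fibre z hx', in_fibre w hy', γ'.prod ζ, fun t => by
    simp [hγ', γ₀]⟩

end CurveLifting

section InjectiveMatrices

section Field

variable {K ι V V' : Type*} [Field K] [AddCommGroup V] [Module K V] [AddCommGroup V'] [Module K V']

theorem linearIndependent_iff_linearIndepOn_compl_singleton {w : ι → V} (j : ι) :
    LinearIndependent K w ↔
      LinearIndepOn K w {j}ᶜ ∧ w j ∉ Submodule.span K (w '' {j}ᶜ) := by
  rw [← linearIndepOn_univ_iff, ← linearIndepOn_insert (by simp), insert_eq, union_compl_self]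

theorem linearIndependent_update_iff [DecidableEq ι] {w : ι → V} (j : ι) (u : V) :
    LinearIndependent K (update w j u) ↔
      LinearIndepOn K w {j}ᶜ ∧ u ∉ Submodule.span K (w '' {j}ᶜ) := by
  have h_eqOn : EqOn (update w j u) w {j}ᶜ := fun i hi => update_of_ne hi _ _
  rw [linearIndependent_iff_linearIndepOn_compl_singleton j, update_self, h_eqOn.image_eq,
    linearIndepOn_congr h_eqOn]

theorem one_lt_rank_quotient_span_image_compl_singleton [Fintype ι] [FiniteDimensional K V]
    (hι : Fintype.card ι < finrank K V) (w : ι → V) (j : ι) :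
    1 < Module.rank K (V ⧸ Submodule.span K (w '' {j}ᶜ)) := by
  classical
  have h_span : finrank K (Submodule.span K (w '' {j}ᶜ)) ≤ Fintype.card ι - 1 := by
    rw [show w '' {j}ᶜ = ((Finset.univ.erase j).image w : Finset V) by ext; simp]
    refine (finrank_span_finset_le_card _).trans (Finset.card_image_le.trans ?_)
    rw [Finset.card_erase_of_mem (Finset.mem_univ j), Finset.card_univ]
  have h_add := Submodule.finrank_quotient_add_finrank (Submodule.span K (w '' {j}ᶜ))
  have h_pos : 0 < Fintype.card ι := Fintype.card_pos_iff.2 ⟨j⟩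
  rw [← finrank_eq_rank, Nat.one_lt_cast]
  lia

theorem exists_injective_and_comp_eq [FiniteDimensional K V] [FiniteDimensional K V']
    (h : finrank K V ≤ finrank K V') (f : V →ₗ[K] V') :
    ∃ (π : V' →ₗ[K] V') (g : V →ₗ[K] V'), Injective g ∧ π ∘ₗ f = f ∧ π ∘ₗ g = f := by
  obtain ⟨C, hC⟩ := Submodule.exists_isCompl (LinearMap.range f)
  have h_ker : finrank K (LinearMap.ker f) ≤ finrank K C := by
    have h_range := Submodule.finrank_add_eq_of_isCompl hC
    have h_rank_nullity := LinearMap.finrank_range_add_finrank_ker f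
    lia
  obtain ⟨i, hi⟩ : ∃ i : LinearMap.ker f →ₗ[K] C, Injective i :=
    lift_rank_le_iff_exists_linearMap.1 (by simpa only [← finrank_eq_rank, Cardinal.lift_natCast,
      Nat.cast_le])
  obtain ⟨i', hi'⟩ := i.exists_extend
  let π := (LinearMap.range f).projection C hC
  have hπf (x : V) : π (f x) = f x :=
    Submodule.projection_apply_of_mem_left hC (LinearMap.mem_range_self f x)
  have hπg (x : V) : π (f x + i' x) = f x := by
    rw [map_add, hπf, Submodule.projection_apply_right hC (i' x), add_zero]
  refine ⟨π, f + C.subtype ∘ₗ i', (injective_iff_map_eq_zero _).2 fun x hx => ?_,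
    LinearMap.ext hπf, LinearMap.ext hπg⟩
  have hfx : f x = 0 := by
    rw [← hπg x]
    exact (congrArg π hx).trans (map_zero π)
  have hix : i ⟨x, hfx⟩ = 0 := by
    rw [← hi']
    exact Subtype.ext (by simpa [hfx] using hx)
  exact congrArg Subtype.val ((injective_iff_map_eq_zero i).1 hi _ hix)

end Field

theorem joinedIn_linearIndependent {ι V : Type*} [Fintype ι] [AddCommGroup V] [Module ℝ V]
    [FiniteDimensional ℝ V] [TopologicalSpace V] [IsTopologicalAddGroup V] [ContinuousSMul ℝ V]
    (hι : Fintype.card ι < finrank ℝ V) {w w' : ι → V} (hw : LinearIndependent ℝ w)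
    (hw' : LinearIndependent ℝ w') : JoinedIn {w : ι → V | LinearIndependent ℝ w} w w' := by
  classical
  have joinedIn_update {w : ι → V} (hw : LinearIndependent ℝ w) {j : ι} {u : V}
      (hu : u ∉ Submodule.span ℝ (w '' {j}ᶜ)) :
      JoinedIn {w : ι → V | LinearIndependent ℝ w} w (update w j u) := by
    obtain ⟨hw_off, hwj⟩ := (linearIndependent_iff_linearIndepOn_compl_singleton j).1 hw
    have h_join := (isPathConnected_compl_of_one_lt_codim
      (one_lt_rank_quotient_span_image_compl_singleton hι w j)).joinedIn _ hwj _ hu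
    simpa using joinedIn_map_of_mapsTo (f := update w j) h_join (by fun_prop) fun v hv =>
      (linearIndependent_update_iff j v).2 ⟨hw_off, hv⟩
  suffices h : ∀ (s : Finset ι) {w w' : ι → V}, LinearIndependent ℝ w →
      LinearIndependent ℝ w' → (∀ i ∉ s, w i = w' i) →
      JoinedIn {w : ι → V | LinearIndependent ℝ w} w w' from
    h Finset.univ hw hw' fun i hi => absurd (Finset.mem_univ i) hi
  intro s
  induction s using Finset.induction with
  | empty => exact fun hw _ h => funext (fun i => h i (Finset.notMem_empty i)) ▸ .refl hw
  | insert j s _ ih =>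
    intro w w' hw hw' h
    obtain ⟨u, hu⟩ := Submodule.exists_forall_notMem_of_forall_ne_top
      (fun b : Bool => Submodule.span ℝ ((bif b then w else w') '' {j}ᶜ)) (by
        have ne_top {w : ι → V} (hw : LinearIndependent ℝ w) :
            Submodule.span ℝ (w '' {j}ᶜ) ≠ ⊤ := fun h_top =>
          ((linearIndependent_iff_linearIndepOn_compl_singleton j).1 hw).2 (by simp [h_top])
        rintro (_ | _)
        exacts [ne_top hw', ne_top hw])
    have h_join := joinedIn_update hw (hu true)
    have h_join' := joinedIn_update hw' (hu false)
    refine h_join.trans ((ih h_join.target_mem h_join'.target_mem fun i hi => ?_).trans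
      h_join'.symm)
    obtain rfl | hij := eq_or_ne i j
    · simp
    · simpa [hij] using h i (by simp [hij, hi])

variable {m p q : Type*} [Fintype p] [Fintype q]

theorem joinedIn_injective_mulVec (hpq : Fintype.card q < Fintype.card p) {W W' : Matrix p q ℝ}
    (hW : Injective W.mulVec) (hW' : Injective W'.mulVec) :
    JoinedIn {W : Matrix p q ℝ | Injective W.mulVec} W W' := by
  rw [mulVec_injective_iff] at hW hW'
  exact joinedIn_map_of_mapsTo (f := Matrix.transpose)
    (joinedIn_linearIndependent (by simpa using hpq) hW hW') (by fun_prop)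
    fun w hw => mulVec_injective_iff.2 hw

theorem exists_continuous_mul_eq_one [DecidableEq q] {T : Type*} [TopologicalSpace T]
    {W : T → Matrix p q ℝ} (hc : Continuous W) (hW : ∀ t, Injective (W t).mulVec) :
    ∃ A : T → Matrix q p ℝ, Continuous A ∧ ∀ t, A t * W t = 1 := by
  have h_gram : Continuous fun t => (W t)ᵀ * W t := hc.matrix_transpose.matrix_mul hc
  have h_det (t : T) : ((W t)ᵀ * W t).det ≠ 0 := by
    simpa only [conjTranspose_eq_transpose_of_trivial] using
      (PosDef.conjTranspose_mul_self (W t) (hW t)).det_pos.ne'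
  refine ⟨fun t => ((W t)ᵀ * W t)⁻¹ * (W t)ᵀ, .matrix_mul ?_ hc.matrix_transpose, fun t => ?_⟩
  · simp only [inv_def, Ring.inverse_eq_inv']
    exact (h_gram.matrix_det.inv₀ h_det).smul h_gram.matrix_adjugate
  · rw [Matrix.mul_assoc, nonsing_inv_mul _ (h_det t).isUnit]

theorem exists_joinedIn_injective_mulVec (hpq : Fintype.card q ≤ Fintype.card p)
    (F : Matrix m p ℝ) (W : Matrix p q ℝ) :
    ∃ (F' : Matrix m p ℝ) (W' : Matrix p q ℝ), Injective W'.mulVec ∧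
      JoinedIn {x : Matrix m p ℝ × Matrix p q ℝ | x.1 * x.2 = F * W} (F, W) (F', W') := by
  classical
  obtain ⟨π, g, hg, hπW, hπg⟩ := exists_injective_and_comp_eq (by simpa using hpq) (toLin' W)
  set P := LinearMap.toMatrix' π
  set W' := LinearMap.toMatrix' g
  have hPW : P * W = W := by
    simpa [LinearMap.toMatrix'_comp, P] using congrArg LinearMap.toMatrix' hπW
  have hPW' : P * W' = W := by
    simpa [LinearMap.toMatrix'_comp, P, W'] using congrArg LinearMap.toMatrix' hπg
  refine ⟨F * P, W', ?_, .trans (y := (F * P, W)) (.of_segment_subset ?_) (.of_segment_subset ?_)⟩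
  · rwa [show W'.mulVec = g from funext fun x => LinearMap.toMatrix'_mulVec g x]
  all_goals
    rintro _ ⟨a, b, -, -, hab, rfl⟩
    simp [Matrix.add_mul, Matrix.mul_add, Matrix.mul_assoc, hPW, hPW', ← add_smul, hab]

theorem liftsCurves_mul (hpq : Fintype.card q < Fintype.card p) :
    LiftsCurves fun x : Matrix m p ℝ × Matrix p q ℝ => x.1 * x.2 := by
  classical
  rintro ⟨F₀, W₀⟩ ⟨F₁, W₁⟩ γ
  obtain ⟨F₀', W₀', hW₀', h_join₀⟩ := exists_joinedIn_injective_mulVec hpq.le F₀ W₀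
  obtain ⟨F₁', W₁', hW₁', h_join₁⟩ := exists_joinedIn_injective_mulVec hpq.le F₁ W₁
  obtain ⟨w, hw⟩ := joinedIn_injective_mulVec hpq hW₀' hW₁'
  obtain ⟨A, hA, hAw⟩ := exists_continuous_mul_eq_one w.continuous hw
  let G : Path F₀' F₁' := PathConnectedSpace.somePath F₀' F₁'
  have h₀ : F₀' * W₀' = F₀ * W₀ := h_join₀.target_mem
  have h₁ : F₁' * W₁' = F₁ * W₁ := h_join₁.target_mem
  let F : Path F₀' F₁' :=
    { toFun := fun t => G t + (γ t - G t * w t) * A t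
      source' := by simp [h₀]
      target' := by simp [h₁] }
  refine ⟨_, _, h_join₀, h_join₁, F.prod w, fun t => ?_⟩
  calc (G t + (γ t - G t * w t) * A t) * w t
      = G t * w t + (γ t - G t * w t) * (A t * w t) := by rw [Matrix.add_mul, Matrix.mul_assoc]
    _ = γ t := by rw [hAw, Matrix.mul_one, add_sub_cancel]

end InjectiveMatrices

section HiddenNeurons

section Field

variable {K ι κ q V : Type*} [Field K]

theorem exists_finset_card_le_finrank_and_span_image_eq [AddCommGroup V] [Module K V]
    [FiniteDimensional K V] (u : κ → V) :
    ∃ J : Finset κ, J.card ≤ finrank K V ∧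
      Submodule.span K (u '' J) = Submodule.span K (range u) := by
  classical
  obtain ⟨β, a, ha, h_span, h_indep⟩ := exists_linearIndependent' K u
  have := h_indep.finite
  have := Fintype.ofFinite β
  refine ⟨Finset.univ.image a, ?_, ?_⟩
  · rw [Finset.card_image_of_injective _ ha]
    exact h_indep.fintype_card_le_finrank
  · rw [Finset.coe_image, Finset.coe_univ, image_univ, ← range_comp, h_span]

theorem exists_mul_eq_and_row_eq_zero [Fintype κ] {U : Matrix ι κ K} {J : Set κ}
    (hJ : Submodule.span K (U.col '' J) = Submodule.span K (range U.col)) (W : Matrix κ q K) :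
    ∃ W' : Matrix κ q K, U * W' = U * W ∧ ∀ k ∉ J, W' k = 0 := by
  have h_col (j : q) : ∃ c : κ → K, U *ᵥ c = U *ᵥ W.col j ∧ ∀ k ∉ J, c k = 0 := by
    have h_mem : U *ᵥ W.col j ∈ Submodule.span K (U.col '' J) := by
      rw [hJ, ← range_mulVecLin]
      exact LinearMap.mem_range_self U.mulVecLin _
    obtain ⟨c, hc, hcU⟩ := (Finsupp.mem_span_image_iff_linearCombination K).1 h_mem
    refine ⟨c, ?_, fun k hk => by_contra fun h => hk (hc (Finsupp.mem_support_iff.2 h))⟩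
    rw [← hcU, Finsupp.linearCombination_apply, Finsupp.sum_fintype _ _ (by simp)]
    ext i
    simp [mulVec, dotProduct, mul_comm]
  choose c hc hcJ using h_col
  exact ⟨Matrix.of fun k j => c j k, Matrix.ext fun i j => congrFun (hc j) i,
    fun k hk => funext fun j => hcJ j k hk⟩

end Field

theorem exists_subset_image_and_subset_image {C κ : Type*} [Nonempty C] (s : Finset C)
    {A B : Finset κ} (hA : s.card ≤ A.card) (hB : s.card ≤ B.card) :
    ∃ Q : κ → C, ↑s ⊆ Q '' A ∧ ↑s ⊆ Q '' B := by
  classical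
  induction s using Finset.induction generalizing A B with
  | empty => simp
  | insert c s hc ih =>
    rw [Finset.card_insert_of_notMem hc] at hA hB
    obtain ⟨a, ha, b, hb, hbA, haB⟩ : ∃ a ∈ A, ∃ b ∈ B, b ∉ A.erase a ∧ a ∉ B.erase b := by
      by_cases h : Disjoint A B
      · obtain ⟨a, ha⟩ := Finset.card_pos.1 (Nat.zero_lt_of_lt hA)
        obtain ⟨b, hb⟩ := Finset.card_pos.1 (Nat.zero_lt_of_lt hB)
        exact ⟨a, ha, b, hb, fun h' => Finset.disjoint_left.1 h (Finset.mem_of_mem_erase h') hb,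
          fun h' => Finset.disjoint_left.1 h ha (Finset.mem_of_mem_erase h')⟩
      · obtain ⟨k, hkA, hkB⟩ := Finset.not_disjoint_iff.1 h
        exact ⟨k, hkA, k, hkB, Finset.notMem_erase k A, Finset.notMem_erase k B⟩
    obtain ⟨Q, hQA, hQB⟩ := ih (A := A.erase a) (B := B.erase b)
      (by rw [Finset.card_erase_of_mem ha]; lia) (by rw [Finset.card_erase_of_mem hb]; lia)
    let Q' : κ → C := fun k => if k = a ∨ k = b then c else Q k
    have subset_image {D D' : Finset κ} {d : κ} (hd : d ∈ D) (hcd : Q' d = c) (hD' : D' ⊆ D)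
        (ha : a ∉ D') (hb : b ∉ D') (hQ : ↑s ⊆ Q '' D') : ↑(insert c s) ⊆ Q' '' D := by
      rw [Finset.coe_insert, insert_subset_iff]
      refine ⟨⟨d, hd, hcd⟩, fun x hx => ?_⟩
      obtain ⟨k, hk, rfl⟩ := hQ hx
      exact ⟨k, hD' hk, if_neg (by rintro (rfl | rfl) <;> contradiction)⟩
    exact ⟨Q', subset_image ha (if_pos (.inl rfl)) (A.erase_subset a) (A.notMem_erase a) hbA hQA,
      subset_image hb (if_pos (.inr rfl)) (B.erase_subset b) haB (B.notMem_erase b) hQB⟩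

variable {C ι κ q : Type*}

/-- The matrix of the outputs of a layer of hidden neurons on all samples: `v c` is the vector of
outputs of a neuron with parameter `c`, and column `k` belongs to the neuron with parameter
`P k`. -/
def featureMatrix (v : C → ι → ℝ) (P : κ → C) : Matrix ι κ ℝ :=
  Matrix.of fun i k => v (P k) i

variable [Fintype κ] [AddCommGroup C] [Module ℝ C] [TopologicalSpace C] [ContinuousAdd C]
  [ContinuousSMul ℝ C]

/-- Once the weights leaving the neurons outside `J` vanish, the parameters of these neurons are
irrelevant. -/
theorem exists_joinedIn_of_eqOn (v : C → ι → ℝ) {P P' : κ → C} {J : Set κ}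
    (hJ : Submodule.span ℝ (v ∘ P '' J) = Submodule.span ℝ (range (v ∘ P))) (hP : EqOn P P' J)
    (W : Matrix κ q ℝ) :
    ∃ W', JoinedIn {x : (κ → C) × Matrix κ q ℝ |
        featureMatrix v x.1 * x.2 = featureMatrix v P * W} (P, W) (P', W') := by
  obtain ⟨W', hW', hW'J⟩ := exists_mul_eq_and_row_eq_zero (U := featureMatrix v P) hJ W
  have h_congr {Q : κ → C} (hQ : EqOn Q P J) : featureMatrix v Q * W' = featureMatrix v P * W' := by
    ext i j
    refine Finset.sum_congr rfl fun k _ => ?_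
    by_cases hk : k ∈ J
    · simp [featureMatrix, hQ hk]
    · simp [hW'J k hk]
  refine ⟨W', .trans (y := (P, W')) (.of_segment_subset ?_) (.of_segment_subset ?_)⟩
  · rintro _ ⟨a, b, -, -, hab, rfl⟩
    simp [← add_smul, hab, Matrix.mul_add, hW']
  · rintro _ ⟨a, b, -, -, hab, rfl⟩
    rw [mem_ofPred_eq, ← hW', ← h_congr (Q := a • P + b • P') fun k hk => by
      simp [← hP hk, ← add_smul, hab]]
    simp [← add_smul, hab]

theorem exists_joinedIn_update [Fintype ι] [DecidableEq κ] (v : C → ι → ℝ)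
    (hκ : Fintype.card ι < Fintype.card κ) (P : κ → C) (c : C) (W : Matrix κ q ℝ) :
    ∃ k W', JoinedIn {x : (κ → C) × Matrix κ q ℝ |
        featureMatrix v x.1 * x.2 = featureMatrix v P * W} (P, W) (update P k c, W') := by
  obtain ⟨J, hJ_card, hJ⟩ := exists_finset_card_le_finrank_and_span_image_eq (K := ℝ) (v ∘ P)
  rw [finrank_fintype_fun_eq_card] at hJ_card
  obtain ⟨k, -, hk⟩ := Finset.exists_mem_notMem_of_card_lt_card
    (hJ_card.trans_lt (hκ.trans_eq Finset.card_univ.symm))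
  exact ⟨k, exists_joinedIn_of_eqOn v hJ
    (fun i hi => (update_of_ne (ne_of_mem_of_not_mem hi hk) _ _).symm) W⟩

theorem exists_joinedIn_of_span_image_compl_eq_top (v : C → ι → ℝ) {P Q : κ → C} {J : Set κ}
    (hJ : Submodule.span ℝ (v ∘ P '' J) = Submodule.span ℝ (range (v ∘ P)))
    (hQ : Submodule.span ℝ (v ∘ Q '' Jᶜ) = ⊤) (W : Matrix κ q ℝ) :
    ∃ W', JoinedIn {x : (κ → C) × Matrix κ q ℝ |
        featureMatrix v x.1 * x.2 = featureMatrix v P * W} (P, W) (Q, W') := by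
  classical
  let R : κ → C := J.piecewise P Q
  have hRQ : EqOn R Q Jᶜ := J.piecewise_eqOn_compl P Q
  have hR : Submodule.span ℝ (v ∘ R '' Jᶜ) = Submodule.span ℝ (range (v ∘ R)) := by
    refine le_antisymm (Submodule.span_mono (image_subset_range _ _)) ?_
    rw [(hRQ.comp_left (g := v)).image_eq, hQ]
    exact le_top
  obtain ⟨W₁, h_join⟩ := exists_joinedIn_of_eqOn v hJ (J.piecewise_eqOn P Q).symm W
  obtain ⟨W₂, h_join'⟩ := exists_joinedIn_of_eqOn v hR hRQ W₁
  rw [show featureMatrix v R * W₁ = featureMatrix v P * W from h_join.target_mem] at h_join'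
  exact ⟨W₂, h_join.trans h_join'⟩

/-- Among `2 * card ι` neurons, those which are not needed for the span of the features are enough
to hold a spanning family of features: both ends of a curve can be moved to the same spanning
parameters `Q`, and then only the output weights have to follow the curve. -/
theorem liftsCurves_featureMatrix_mul [Fintype ι] {v : C → ι → ℝ}
    (hv : Submodule.span ℝ (range v) = ⊤) (hκ : 2 * Fintype.card ι ≤ Fintype.card κ) :
    LiftsCurves fun x : (κ → C) × Matrix κ q ℝ => featureMatrix v x.1 * x.2 := by
  classical
  rintro ⟨P, W⟩ ⟨P', W'⟩ γ
  obtain ⟨J, hJ, hJP⟩ := exists_finset_card_le_finrank_and_span_image_eq (K := ℝ) (v ∘ P)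
  obtain ⟨J', hJ', hJP'⟩ := exists_finset_card_le_finrank_and_span_image_eq (K := ℝ) (v ∘ P')
  obtain ⟨s, hs, hsv⟩ := exists_finset_card_le_finrank_and_span_image_eq (K := ℝ) v
  rw [finrank_fintype_fun_eq_card] at hJ hJ' hs
  obtain ⟨Q, hQ, hQ'⟩ := exists_subset_image_and_subset_image s (A := Jᶜ) (B := J'ᶜ)
    (by rw [Finset.card_compl]; lia) (by rw [Finset.card_compl]; lia)
  have span_eq_top {A : Set κ} (hA : ↑s ⊆ Q '' A) : Submodule.span ℝ (v ∘ Q '' A) = ⊤ := by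
    rw [eq_top_iff, ← hv, ← hsv, image_comp]
    exact Submodule.span_mono (image_mono hA)
  obtain ⟨W₁, h_join⟩ := exists_joinedIn_of_span_image_compl_eq_top v hJP
    (span_eq_top (by simpa using hQ)) W
  obtain ⟨W₁', h_join'⟩ := exists_joinedIn_of_span_image_compl_eq_top v hJP'
    (span_eq_top (by simpa using hQ')) W'
  set Y := featureMatrix v Q
  have hW₁ : Y * W₁ = featureMatrix v P * W := h_join.target_mem
  have hW₁' : Y * W₁' = featureMatrix v P' * W' := h_join'.target_mem
  obtain ⟨Z, hZ⟩ : ∃ Z : Matrix κ ι ℝ, Y * Z = 1 := by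
    rw [← mulVec_surjective_iff_exists_right_inverse, ← coe_mulVecLin, ← LinearMap.range_eq_top,
      range_mulVecLin, ← image_univ]
    exact span_eq_top (hQ.trans (image_mono (subset_univ _)))
  let w : Path W₁ W₁' := PathConnectedSpace.somePath W₁ W₁'
  let w' : Path W₁ W₁' :=
    { toFun := fun t => w t + Z * (γ t - Y * w t)
      source' := by simp [hW₁]
      target' := by simp [hW₁'] }
  refine ⟨_, _, h_join, h_join', (Path.refl Q).prod w', fun t => ?_⟩
  calc Y * (w t + Z * (γ t - Y * w t)) = Y * w t + Y * Z * (γ t - Y * w t) := by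
        rw [Matrix.mul_add, Matrix.mul_assoc]
    _ = γ t := by rw [hZ, Matrix.one_mul, add_sub_cancel]

end HiddenNeurons

section Activation

variable {σ : ℝ → ℝ} {ι κ : Type*}

theorem NoTranslateRelation.exists_ne_sum (hσ : NoTranslateRelation σ) {s : Finset ι} {c a : ι → ℝ}
    (hc : ∀ i ∈ s, c i ≠ 0) (ha : ∀ i ∈ s, a i ≠ 0) (ha_inj : InjOn a s) :
    ∃ x, σ x ≠ ∑ i ∈ s, c i * σ (x - a i) := by
  by_contra! h
  let e := s.equivFin.symm
  refine hσ ⟨s.card, fun k => c (e k), fun k => a (e k), fun k => hc _ (e k).2,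
    fun k => ha _ (e k).2, fun k l hkl h_eq => hkl ?_, fun x => ?_⟩
  · exact e.injective (Subtype.ext (ha_inj (e k).2 (e l).2 h_eq))
  · rw [h x, ← Finset.sum_coe_sort, ← e.sum_comp]

theorem NoTranslateRelation.linearIndependent_translates (hσ : NoTranslateRelation σ) {t : ι → ℝ}
    (ht : Injective t) : LinearIndependent ℝ fun i (x : ℝ) => σ (t i + x) := by
  classical
  refine linearIndependent_iff'.2 fun s g hg j hj => by_contra fun hgj => ?_
  let s' := (s.erase j).filter fun i => g i ≠ 0
  have hs' {i : ι} (hi : i ∈ s') : i ≠ j ∧ g i ≠ 0 :=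
    ⟨Finset.ne_of_mem_erase (Finset.mem_of_mem_filter i hi), (Finset.mem_filter.1 hi).2⟩
  obtain ⟨x, hx⟩ := hσ.exists_ne_sum (s := s') (c := fun i => -(g i / g j))
    (a := fun i => t j - t i) (fun i hi => neg_ne_zero.2 (div_ne_zero (hs' hi).2 hgj))
    (fun i hi => sub_ne_zero.2 (ht.ne (hs' hi).1.symm)) fun i _ k _ h => ht (sub_right_injective h)
  have h_rel : g j * σ x + ∑ i ∈ s', g i * σ (t i + (x - t j)) = 0 := by
    rw [Finset.sum_filter_of_ne fun i _ h => left_ne_zero_of_mul h]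
    have h_eval := congrFun hg (x - t j)
    simp only [Finset.sum_apply, Pi.smul_apply, smul_eq_mul, Pi.zero_apply] at h_eval
    rwa [← Finset.add_sum_erase s _ hj, add_sub_cancel] at h_eval
  refine hx (mul_left_cancel₀ hgj ?_)
  rw [eq_neg_of_add_eq_zero_left h_rel, ← Finset.sum_neg_distrib, Finset.mul_sum]
  refine Finset.sum_congr rfl fun i _ => ?_
  rw [show x - (t j - t i) = t i + (x - t j) by ring]
  field_simp

/-- The outputs on all samples (the rows of `X`) of a neuron with weights `c.1` and
bias `c.2`. -/
def neuronFeature [Fintype κ] (σ : ℝ → ℝ) (X : Matrix ι κ ℝ) (c : (κ → ℝ) × ℝ) : ι → ℝ :=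
  fun i => σ (X i ⬝ᵥ c.1 + c.2)

theorem exists_injective_dotProduct [Finite ι] [Fintype κ] {X : Matrix ι κ ℝ} (hX : Injective X) :
    ∃ w : κ → ℝ, Injective fun i => X i ⬝ᵥ w := by
  classical
  obtain ⟨f, hf⟩ := exists_dual_forall_apply_ne_zero (K := ℝ)
    (fun ij : {ij : ι × ι // ij.1 ≠ ij.2} => X ij.1.1 - X ij.1.2)
    (fun ij => sub_ne_zero.2 (hX.ne ij.2))
  obtain ⟨w, rfl⟩ := (dotProductEquiv ℝ κ).surjective f
  refine ⟨w, fun i j hij => by_contra fun h => hf ⟨(i, j), h⟩ ?_⟩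
  simpa [dotProduct_comm w, sub_eq_zero] using hij

theorem NoTranslateRelation.span_range_neuronFeature [Finite ι] [Fintype κ]
    (hσ : NoTranslateRelation σ) {X : Matrix ι κ ℝ} (hX : Injective X) :
    Submodule.span ℝ (range (neuronFeature σ X)) = ⊤ := by
  obtain ⟨w, hw⟩ := exists_injective_dotProduct hX
  rw [eq_top_iff, ← span_flip_eq_top_iff_linearIndependent.2 (hσ.linearIndependent_translates hw)]
  refine Submodule.span_mono ?_
  rintro _ ⟨b, rfl⟩
  exact ⟨(w, b), rfl⟩

theorem StrictlyMonotoneOnto.exists_homeomorph (hσ : StrictlyMonotoneOnto σ) :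
    ∃ e : ℝ ≃ₜ ℝ, ⇑e = σ := by
  obtain ⟨h_mono | h_anti, h_range⟩ := hσ
  · exact ⟨(h_mono.orderIsoOfSurjective σ (range_eq_univ.1 h_range)).toHomeomorph, rfl⟩
  · have h_mono : StrictMono (σ ∘ Neg.neg) := fun x y hxy => h_anti (neg_lt_neg hxy)
    have h_surj : Surjective (σ ∘ Neg.neg) := (range_eq_univ.1 h_range).comp neg_surjective
    refine ⟨(Homeomorph.neg ℝ).trans (h_mono.orderIsoOfSurjective _ h_surj).toHomeomorph, ?_⟩
    exact funext fun x => congrArg σ (neg_neg x)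

theorem StrictlyMonotoneOnto.exists_homeomorph_matrix (hσ : StrictlyMonotoneOnto σ) :
    ∃ e : Matrix ι κ ℝ ≃ₜ Matrix ι κ ℝ, ∀ A, e A = A.map σ := by
  obtain ⟨e, rfl⟩ := hσ.exists_homeomorph
  let e' : Matrix ι κ ℝ ≃ₜ Matrix ι κ ℝ :=
    { toEquiv := e.toEquiv.mapMatrix
      continuous_toFun := continuous_id.matrix_map e.continuous
      continuous_invFun := continuous_id.matrix_map e.symm.continuous }
  exact ⟨e', fun _ => rfl⟩

end Activation

section Layers

theorem LiftsCurves.curveConnected_preimage_add {A W Z T D D' : Type*} [TopologicalSpace A]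
    [TopologicalSpace W] [TopologicalSpace Z] [PathConnectedSpace Z] [TopologicalSpace T]
    [TopologicalSpace D] [AddCommGroup D] [IsTopologicalAddGroup D] [TopologicalSpace D']
    {f : A × W → D} (hf : LiftsCurves f) {g : Z → D} (hg : Continuous g) (e : D ≃ₜ D')
    {S : Set (D' × T)} (hS : CurveConnected S) :
    CurveConnected {x : A × ((W × Z) × T) | (e (f (x.1, x.2.1.1) + g x.2.1.2), x.2.2) ∈ S} :=
  CurveConnected.preimage_homeomorph
    (((hf.add hg).homeomorph_comp e).prodMap_id.curveConnected_preimage hS)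
    ((Homeomorph.prodAssoc A (W × Z) T).symm.trans
      ((Homeomorph.prodAssoc A W Z).symm.prodCongr (.refl T)))

/-- The parameters of a single layer of width `q` on top of a layer of width `p`: the weight
matrix and the bias vector. -/
abbrev LayerParams (p q : ℕ) : Type := Matrix (Fin p) (Fin q) ℝ × (Fin q → ℝ)

/-- The parameters of a layer, regrouped neuron by neuron: neuron `k` has the `k`-th column of the
weight matrix and the `k`-th entry of the bias vector. -/
def neuronsHomeomorph (p q : ℕ) : LayerParams p q ≃ₜ (Fin q → (Fin p → ℝ) × ℝ) where
  toFun x k := (fun i => x.1 i k, x.2 k)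
  invFun P := (Matrix.of fun i k => (P k).1 i, fun k => (P k).2)
  left_inv _ := rfl
  right_inv _ := rfl
  continuous_toFun := by fun_prop
  continuous_invFun := by fun_prop

/-- The parameters of a network, split into those of the first layer and those of the remaining
network, which takes the output of the first layer as its data. -/
def splitFirst (L : ℕ) (n : ℕ → ℕ) :
    Params (L + 1) n ≃ₜ LayerParams (n 0) (n 1) × Params L (fun k => n (k + 1)) where
  toFun θ := (θ 0, Fin.tail θ)
  invFun x := Fin.cons x.1 x.2
  left_inv θ := Fin.cons_self_tail θ
  right_inv _ := rfl
  continuous_toFun := by unfold Fin.tail; fun_prop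
  continuous_invFun := by fun_prop

/-- The parameters of a network, split into the neurons of the first layer, the parameters of the
second layer and those of the remaining network. -/
def splitFirstTwo (L : ℕ) (n : ℕ → ℕ) :
    Params (L + 2) n ≃ₜ (Fin (n 1) → (Fin (n 0) → ℝ) × ℝ) ×
      (LayerParams (n 1) (n 2) × Params L (fun k => n (k + 2))) :=
  (splitFirst (L + 1) n).trans
    ((neuronsHomeomorph (n 0) (n 1)).prodCongr (splitFirst L fun k => n (k + 1)))

variable {N L : ℕ} {n : ℕ → ℕ} {σ : ℝ → ℝ}

theorem layerOutput_succ_eq_tail (X : Matrix (Fin N) (Fin (n 0)) ℝ) (θ : Params (L + 1) n) {k : ℕ}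
    (hk : k ≤ L) :
    layerOutput σ X θ (k + 1) (Nat.succ_le_succ hk) =
      layerOutput (n := fun k => n (k + 1)) σ (layerOutput σ X θ 1 (Nat.le_add_left 1 L))
        (splitFirst L n θ).2 k hk := by
  induction k with
  | zero => rfl
  | succ k ih =>
    rw [layerOutput, ih (Nat.le_of_succ_le hk), layerOutput]
    simp only [Nat.add_right_cancel_iff]
    rfl

theorem layerOutput_one_eq_ite (X : Matrix (Fin N) (Fin (n 0)) ℝ) (θ : Params (L + 1) n) :
    layerOutput σ X θ 1 (Nat.le_add_left 1 L) =
      let A := X * (splitFirst L n θ).1.1 + replicateRow (Fin N) (splitFirst L n θ).1.2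
      if L = 0 then A else A.map σ := by
  rw [layerOutput]
  exact if_congr (by lia) rfl rfl

theorem StrictlyMonotoneOnto.exists_homeomorph_layerOutput_one (hσ : StrictlyMonotoneOnto σ)
    (L N : ℕ) (n : ℕ → ℕ) :
    ∃ e : Matrix (Fin N) (Fin (n 1)) ℝ ≃ₜ Matrix (Fin N) (Fin (n 1)) ℝ,
      ∀ (X : Matrix (Fin N) (Fin (n 0)) ℝ) (θ : Params (L + 1) n),
        layerOutput σ X θ 1 (Nat.le_add_left 1 L) =
          e (X * (splitFirst L n θ).1.1 + replicateRow (Fin N) (splitFirst L n θ).1.2) := by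
  obtain rfl | hL := eq_or_ne L 0
  · exact ⟨.refl _, fun X θ => layerOutput_one_eq_ite X θ⟩
  · obtain ⟨e, he⟩ := hσ.exists_homeomorph_matrix
    exact ⟨e, fun X θ => by rw [he, layerOutput_one_eq_ite X θ, if_neg hL]⟩

theorem layerOutput_one_eq_featureMatrix (X : Matrix (Fin N) (Fin (n 0)) ℝ)
    (θ : Params (L + 2) n) :
    layerOutput σ X θ 1 (Nat.le_add_left 1 (L + 1)) =
      featureMatrix (neuronFeature σ X) (splitFirstTwo L n θ).1 := by
  rw [layerOutput_one_eq_ite, if_neg L.succ_ne_zero]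
  rfl

theorem curveConnected_preimage_layerOutput_of_strictAntiOn (hn : StrictAntiOn n (Iic L))
    (hσ : StrictlyMonotoneOnto σ) {S : Set (Matrix (Fin N) (Fin (n L)) ℝ)}
    (hS : CurveConnected S) :
    CurveConnected {x : Matrix (Fin N) (Fin (n 0)) ℝ × Params L n |
      layerOutput σ x.1 x.2 L le_rfl ∈ S} := by
  induction L generalizing n with
  | zero =>
    have h_prod := hS.prod (curveConnected_univ (E := Params 0 n))
    rw [prod_univ] at h_prod
    exact h_prod
  | succ L ih =>
    have hn_tail : StrictAntiOn (fun k => n (k + 1)) (Iic L) := fun i hi j hj hij =>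
      hn (Nat.succ_le_succ hi) (Nat.succ_le_succ hj) (Nat.succ_lt_succ hij)
    have h_width : n 1 < n 0 := hn (Nat.zero_le _) (Nat.le_add_left 1 L) Nat.one_pos
    obtain ⟨e, he⟩ := hσ.exists_homeomorph_layerOutput_one L N n
    have h_split := (liftsCurves_mul (m := Fin N) (p := Fin (n 0)) (q := Fin (n 1))
      (by simpa using h_width)).curveConnected_preimage_add
      continuous_id.matrix_replicateRow e (ih hn_tail hS)
    convert h_split.preimage_homeomorph ((Homeomorph.refl _).prodCongr (splitFirst L n)) using 1
    ext x
    simp [layerOutput_succ_eq_tail x.1 x.2 le_rfl, he]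

theorem layerOutput_succ_succ_eq_tail (M : ℕ) (X : Matrix (Fin N) (Fin (n 0)) ℝ)
    (θ : Params (M + 2) n) :
    layerOutput σ X θ (M + 2) le_rfl =
      layerOutput (n := fun k => n (k + 2)) σ
        (layerOutput (n := fun k => n (k + 1)) σ
          (featureMatrix (neuronFeature σ X) (splitFirstTwo M n θ).1)
          (splitFirst (M + 1) n θ).2 1 (Nat.le_add_left 1 M))
        (splitFirstTwo M n θ).2.2 M le_rfl := by
  rw [layerOutput_succ_eq_tail X θ (Nat.le_refl (M + 1)), layerOutput_succ_eq_tail _ _ le_rfl,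
    layerOutput_one_eq_featureMatrix]
  rfl

theorem curveConnected_preimage_layerOutput {M : ℕ} {X : Matrix (Fin N) (Fin (n 0)) ℝ}
    (hσ : StrictlyMonotoneOnto σ) (hσ_transl : NoTranslateRelation σ) (hX : Injective X)
    (hn₁ : 2 * N ≤ n 1) (hn : StrictAntiOn n (Icc 2 (M + 2)))
    {S : Set (Matrix (Fin N) (Fin (n (M + 2))) ℝ)} (hS : CurveConnected S) :
    CurveConnected {θ : Params (M + 2) n | layerOutput σ X θ (M + 2) le_rfl ∈ S} := by
  have hn_tail : StrictAntiOn (fun k => n (k + 2)) (Iic M) := fun i hi j hj hij =>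
    hn ⟨by lia, Nat.add_le_add_right hi 2⟩ ⟨by lia, Nat.add_le_add_right hj 2⟩
      (Nat.add_lt_add_right hij 2)
  obtain ⟨e, he⟩ := hσ.exists_homeomorph_layerOutput_one M N fun k => n (k + 1)
  have h_split := (liftsCurves_featureMatrix_mul (q := Fin (n 2)) (κ := Fin (n 1))
    (hσ_transl.span_range_neuronFeature hX) (by simpa using hn₁)).curveConnected_preimage_add
      continuous_id.matrix_replicateRow e
      (curveConnected_preimage_layerOutput_of_strictAntiOn hn_tail hσ hS)
  convert h_split.preimage_homeomorph (splitFirstTwo M n) using 1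
  ext θ
  simp only [layerOutput_succ_succ_eq_tail, he]
  rfl

theorem layerOutput_eq_of_featureMatrix_mul_eq {M : ℕ} {X : Matrix (Fin N) (Fin (n 0)) ℝ}
    {P P' : Fin (n 1) → (Fin (n 0) → ℝ) × ℝ} {W W' : Matrix (Fin (n 1)) (Fin (n 2)) ℝ}
    (h : featureMatrix (neuronFeature σ X) P * W = featureMatrix (neuronFeature σ X) P' * W')
    (b : Fin (n 2) → ℝ) (τ : Params M fun k => n (k + 2)) :
    layerOutput σ X ((splitFirstTwo M n).symm (P, (W, b), τ)) (M + 2) le_rfl =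
      layerOutput σ X ((splitFirstTwo M n).symm (P', (W', b), τ)) (M + 2) le_rfl := by
  simp only [layerOutput_succ_succ_eq_tail, layerOutput_one_eq_ite]
  exact congrArg (fun A => layerOutput (n := fun k => n (k + 2)) σ
    (if M = 0 then A + replicateRow (Fin N) b else (A + replicateRow (Fin N) b).map σ)
    τ M le_rfl) h

theorem exists_joinedIn_layerOutput_eq_and_bias_eq {M : ℕ} (X : Matrix (Fin N) (Fin (n 0)) ℝ)
    (hn₁ : N < n 1) (θ : Params (M + 2) n) (R : ℝ) :
    ∃ θ' : Params (M + 2) n, (∃ k, (θ' 0).2 k = R) ∧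
      JoinedIn {ϑ | layerOutput σ X ϑ (M + 2) le_rfl = layerOutput σ X θ (M + 2) le_rfl} θ θ' := by
  obtain ⟨⟨P, ⟨W, b⟩, τ⟩, rfl⟩ := (splitFirstTwo M n).symm.surjective θ
  obtain ⟨k, W', h_join⟩ := exists_joinedIn_update (neuronFeature σ X) (by simpa using hn₁) P
    (0, R) W
  refine ⟨(splitFirstTwo M n).symm (update P k (0, R), (W', b), τ), ⟨k, ?_⟩, ?_⟩
  · exact congrArg Prod.snd (update_self k _ P)
  · exact joinedIn_map_of_mapsTo (f := fun y => (splitFirstTwo M n).symm (y.1, (y.2, b), τ))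
      h_join (by fun_prop) fun y hy => layerOutput_eq_of_featureMatrix_mul_eq hy b τ

end Layers

section Components

variable {E : Type*} [TopologicalSpace E] {S C : Set E}

theorem IsComponent.mem_of_joinedIn (hC : IsComponent S C) {x y : E} (hx : x ∈ C)
    (hxy : JoinedIn S x y) : y ∈ C := by
  have h_path : IsPathConnected (pathComponentIn S x) :=
    isPathConnected_pathComponentIn hxy.source_mem
  exact hC.2.2 ⟨pathComponentIn_subset, h_path.joinedIn⟩
    (fun z hz => (hC.2.1.2 x hx z hz).mono hC.2.1.1) hxy

theorem IsComponent.eq_of_curveConnected (hC : IsComponent S C) (hS : CurveConnected S) : C = S :=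
  hC.2.1.1.antisymm (hC.2.2 ⟨Subset.rfl, hS⟩ hC.2.1.1)

variable {Φ : E → ℝ}

theorem curveConnected_sublevelSet_of_convexOn [AddCommGroup E] [Module ℝ E] [ContinuousAdd E]
    [ContinuousSMul ℝ E] (hΦ : ConvexOn ℝ univ Φ) (α : ℝ) : CurveConnected (sublevelSet Φ α) := by
  refine curveConnected_of_convex ?_
  simpa only [mem_univ, true_and, sublevelSet] using hΦ.convex_le α

theorem curveConnected_strictSublevelSet (hΦ : ∀ α, CurveConnected (sublevelSet Φ α)) (α : ℝ) :
    CurveConnected (strictSublevelSet Φ α) := fun x hx y hy =>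
  (hΦ (max (Φ x) (Φ y)) x (le_max_left (Φ x) (Φ y)) y (le_max_right (Φ x) (Φ y))).mono
    fun z hz => show Φ z < α from lt_of_le_of_lt hz (max_lt hx hy)

theorem curveConnected_globalMinima (hΦ : ∀ α, CurveConnected (sublevelSet Φ α)) :
    CurveConnected (globalMinima Φ) := fun x hx y hy =>
  (hΦ (Φ x) x (le_refl (Φ x)) y (hy x)).mono fun _ hz w => le_trans hz (hx w)

theorem IsComponent.globalMinima_subset (hΦ : ∀ α, CurveConnected (sublevelSet Φ α)) {α : ℝ}
    (hC : IsComponent (strictSublevelSet Φ α) C) : globalMinima Φ ⊆ C := by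
  obtain ⟨y, hy⟩ := hC.1
  rw [hC.eq_of_curveConnected (curveConnected_strictSublevelSet hΦ α)] at hy ⊢
  exact fun x hx => lt_of_le_of_lt (hx y) hy

theorem not_boundedParams_of_isComponent_levelSet {N M : ℕ} {n : ℕ → ℕ} {σ : ℝ → ℝ}
    {X : Matrix (Fin N) (Fin (n 0)) ℝ} {φ : Matrix (Fin N) (Fin (n (M + 2))) ℝ → ℝ}
    (hn₁ : N < n 1) {α : ℝ} {C : Set (Params (M + 2) n)}
    (hC : IsComponent (levelSet (loss σ X φ) α) C) : ¬ BoundedParams C := by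
  rintro ⟨R, hR⟩
  obtain ⟨θ, hθ⟩ := hC.1
  obtain ⟨θ', ⟨k, hk⟩, h_join⟩ :=
    exists_joinedIn_layerOutput_eq_and_bias_eq (σ := σ) X hn₁ θ (R + 1)
  have hθ' : θ' ∈ C := hC.mem_of_joinedIn hθ <| h_join.mono fun ϑ hϑ =>
    (congrArg φ hϑ).trans (hC.2.1.1 hθ)
  have h_bound := (le_abs_self _).trans ((hR θ' hθ' 0).2 k)
  linarith

end Components

end DeepNet

theorem theorem3_general
    (N L : ℕ) (hN : 1 ≤ N) (hL : 2 ≤ L) (n : ℕ → ℕ)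
    (hn₁ : 2 * N ≤ n 1) (hn : StrictAntiOn n (Set.Icc 2 L))
    (σ : ℝ → ℝ) (hσ₁ : DeepNet.StrictlyMonotoneOnto σ) (hσ₂ : DeepNet.NoTranslateRelation σ)
    (X : Matrix (Fin N) (Fin (n 0)) ℝ) (hX : ∀ i j, i ≠ j → X i ≠ X j)
    (φ : Matrix (Fin N) (Fin (n L)) ℝ → ℝ)
    (hφ : ∀ α, DeepNet.CurveConnected (DeepNet.sublevelSet φ α)) :
    (∀ α : ℝ, DeepNet.CurveConnected
      (DeepNet.sublevelSet (DeepNet.loss (L := L) (n := n) σ X φ) α)) ∧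
    (∀ (α : ℝ) (C : Set (DeepNet.Params L n)),
      DeepNet.IsComponent (DeepNet.levelSet (DeepNet.loss σ X φ) α) C →
        ¬ DeepNet.BoundedParams C) ∧
    DeepNet.CurveConnected (DeepNet.globalMinima (DeepNet.loss (L := L) (n := n) σ X φ)) ∧
    (∀ (α : ℝ) (V : Set (DeepNet.Params L n)),
      DeepNet.IsComponent (DeepNet.strictSublevelSet (DeepNet.loss σ X φ) α) V →
        DeepNet.globalMinima (DeepNet.loss σ X φ) ⊆ V ∧
        ∀ V' : Set (DeepNet.Params L n),
          DeepNet.IsComponent (DeepNet.strictSublevelSet (DeepNet.loss σ X φ) α) V' →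
            V' = V) := by
  obtain ⟨M, rfl⟩ := Nat.exists_eq_add_of_le' hL
  have h_sublevel (α : ℝ) :
      DeepNet.CurveConnected (DeepNet.sublevelSet (DeepNet.loss (n := n) σ X φ) α) :=
    DeepNet.curveConnected_preimage_layerOutput hσ₁ hσ₂ (fun i j => not_imp_not.1 (hX i j))
      hn₁ hn (hφ α)
  have h_strict := DeepNet.curveConnected_strictSublevelSet h_sublevel
  refine ⟨h_sublevel, fun α C => DeepNet.not_boundedParams_of_isComponent_levelSet (by lia),
    DeepNet.curveConnected_globalMinima h_sublevel, fun α V hV =>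
      ⟨hV.globalMinima_subset h_sublevel, fun V' hV' => ?_⟩⟩
  rw [hV.eq_of_curveConnected (h_strict α), hV'.eq_of_curveConnected (h_strict α)]

theorem theorem3
    (N L : ℕ) (hN : 1 ≤ N) (hL : 2 ≤ L) (n : ℕ → ℕ)
    (hn₁ : 2 * N ≤ n 1) (hn : StrictAntiOn n (Set.Icc 2 L))
    (σ : ℝ → ℝ) (hσ : Continuous σ)
    (hσ₁ : DeepNet.StrictlyMonotoneOnto σ) (hσ₂ : DeepNet.NoTranslateRelation σ)
    (X : Matrix (Fin N) (Fin (n 0)) ℝ) (hX : ∀ i j, i ≠ j → X i ≠ X j)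
    (φ : Matrix (Fin N) (Fin (n L)) ℝ → ℝ) (hφ : ConvexOn ℝ Set.univ φ) :
    -- every sublevel set is connected
    (∀ α : ℝ, DeepNet.CurveConnected
      (DeepNet.sublevelSet (DeepNet.loss (L := L) (n := n) σ X φ) α)) ∧
    -- every connected component of every level set is unbounded
    (∀ (α : ℝ) (C : Set (DeepNet.Params L n)),
      DeepNet.IsComponent (DeepNet.levelSet (DeepNet.loss σ X φ) α) C →
        ¬ DeepNet.BoundedParams C) ∧
    -- the global minima are connected, and at each level there is at most one valley
    -- (connected component of the strict sublevel set), which contains all of them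
    DeepNet.CurveConnected (DeepNet.globalMinima (DeepNet.loss (L := L) (n := n) σ X φ)) ∧
    (∀ (α : ℝ) (V : Set (DeepNet.Params L n)),
      DeepNet.IsComponent (DeepNet.strictSublevelSet (DeepNet.loss σ X φ) α) V →
        DeepNet.globalMinima (DeepNet.loss σ X φ) ⊆ V ∧
        ∀ V' : Set (DeepNet.Params L n),
          DeepNet.IsComponent (DeepNet.strictSublevelSet (DeepNet.loss σ X φ) α) V' →
            V' = V) := by
  exact theorem3_general N L hN hL n hn₁ hn σ hσ₁ hσ₂ X hX φ
    (DeepNet.curveConnected_sublevelSet_of_convexOn hφ)
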